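/- Let $\varphi=\frac{1+\sqrt5}{2}$ and let $x_{\rm F}=0100101001001\ldots$ be the infinite Fibonacci word, the limit of the words $f^k(0)$ for the morphism $f:0\mapsto 01,\ 1\mapsto 0$. Let $w$ be a non-empty factor of $x_{\rm F}$ that has no overlap in $x_{\rm F}$, i.e., there are no non-empty words $x,y,z$ such that $w=xy=yz$ and $xyz$ is a factor of $x_{\rm F}$. Write $x_{\rm F}=r_0(w)\,r_1(w)\,r_2(w)\cdots$, where $r_0(w)$ is the prefix of $x_{\rm F}$ that precedes the first occurrence of $w$ and, for $k\ge 1$, $r_k(w)$ is the block from the beginning of the $k$-th occurrence of $w$ up to (not including) the beginning of the $(k+1)$-st occurrence. Suppose that $$|r_0(w)|\le |r_1(w)|-|w|.\qquad\text{(SR0)}$$ Let $Y=Y_1Y_2Y_3\ldots$ be the infinite word over $\{0,1,2\}$ obtained from $x_{\rm F}$ by replacing every occurrence of $w$, consecutively from left to right, by the letter $2$, and let $Y^{-1}(a)=\{n\ge 1: Y_n=a\}$. Then each of the sets $Y^{-1}(0)$, $Y^{-1}(1)$, $Y^{-1}(2)$ is a union of finitely many (possibly no) strictly increasing generalized Beatty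 sequences $V(n)=p\lfloor n\varphi\rfloor+qn+r$ with integers $p,q,r$, each indexed either by $n\ge 1$ or by $n\ge 0$. -/

import Mathlib

/-- The block `x i, x (i+1), …, x (j-1)` of the infinite word `x` (letters indexed from `0`). -/
def wordSegment {A : Type*} (x : ℕ → A) (i j : ℕ) : List A :=
  (List.range (j - i)).map fun k => x (i + k)

/-- The finite word `w` occurs in the infinite word `x`, starting at index `i`. -/
def OccursAt {A : Type*} (x : ℕ → A) (w : List A) (i : ℕ) : Prop :=
  wordSegment x i (i + w.length) = w

instance {A : Type*} [DecidableEq A] (x : ℕ → A) (w : List A) : DecidablePred (OccursAt x w) :=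
  fun i => inferInstanceAs (Decidable (wordSegment x i (i + w.length) = w))

/-- `w` is a factor of `x`. -/
def IsFactor {A : Type*} (x : ℕ → A) (w : List A) : Prop :=
  ∃ i, OccursAt x w i

/-- `w` has an overlap in `x`: there are non-empty words `u`, `v`, `z` with `w = uv = vz`
such that `uvz` is a factor of `x`. -/
def HasOverlap {A : Type*} (x : ℕ → A) (w : List A) : Prop :=
  ∃ u v z : List A, u ≠ [] ∧ v ≠ [] ∧ z ≠ [] ∧ w = u ++ v ∧ w = v ++ z ∧
    IsFactor x (u ++ v ++ z)

/-- The decomposition `x = r₀(w) r₁(w) r₂(w) …` of `x` by the consecutive occurrences of `w`: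
`r₀(w)` is the prefix of `x` before the first occurrence, and `r_k(w)` (`k ≥ 1`) is the block from
the beginning of the `k`-th occurrence up to the beginning of the `(k+1)`-st one.
(`Nat.nth` counts from `0`; it is used for words `w` that occur infinitely often.) -/
noncomputable def returnWord {A : Type*} (x : ℕ → A) (w : List A) : ℕ → List A
  | 0 => wordSegment x 0 (Nat.nth (OccursAt x w) 0)
  | k + 1 => wordSegment x (Nat.nth (OccursAt x w) k) (Nat.nth (OccursAt x w) (k + 1))

/-- The Fibonacci morphism `0 ↦ 01`, `1 ↦ 0` on words over `{0, 1}`. -/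
def fibMorphism (u : List ℕ) : List ℕ :=
  u.flatMap fun a => if a = 0 then [0, 1] else [0]

/-- The infinite Fibonacci word `0100101001001…`, the limit of the words `f^k(0)` for the Fibonacci
morphism `f`. These words are prefixes of each other and `f^n(0)` has more than `n` letters, so the
letter with index `n` can be read off from `f^n(0)`. -/
def fibWord (n : ℕ) : ℕ :=
  (fibMorphism^[n] [0]).getD n 0

/-- Reading `x` from left to right and replacing `w` by a single letter whenever it is met:
`replaceStart x w n` is the index in `x` at which the piece of `x` begins that becomes the letter
with index `n` of the new word. -/
def replaceStart {A : Type*} [DecidableEq A] (x : ℕ → A) (w : List A) : ℕ → ℕ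
  | 0 => 0
  | n + 1 =>
    if OccursAt x w (replaceStart x w n) then replaceStart x w n + w.length
    else replaceStart x w n + 1

/-- The transform `T : [w ↦ c]`: the infinite word obtained from `x` by replacing, consecutively
from left to right, the occurrences of `w` by the letter `c`. -/
def wordReplace {A : Type*} [DecidableEq A] (w : List A) (c : A) (x : ℕ → A) (n : ℕ) : A :=
  if OccursAt x w (replaceStart x w n) then c else x (replaceStart x w n)

/-- `y⁻¹(a)`: the set of positions of the letter `a` in the infinite word `y`, where the first letter
of `y` has position `1`. -/
def letterPositions {A : Type*} (y : ℕ → A) (a : A) : Set ℤ :=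
  {m | ∃ n : ℕ, y n = a ∧ m = (n : ℤ) + 1}

/-- `V` is a generalized Beatty sequence for `α`: `V(n) = p⌊nα⌋ + qn + r` with integers
`p`, `q`, `r`. -/
def IsGBS (α : ℝ) (V : ℕ → ℤ) : Prop :=
  ∃ p q r : ℤ, ∀ n : ℕ, V n = p * ⌊(n : ℝ) * α⌋ + q * (n : ℤ) + r

/-- `S` is the union of finitely many (possibly no) strictly increasing generalized Beatty sequences
for `α`, each of which is indexed either by `{0, 1, 2, …}` or by `{1, 2, 3, …}`. -/
def IsFiniteUnionGBS (α : ℝ) (S : Set ℤ) : Prop :=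
  ∃ (k : ℕ) (V : Fin k → ℕ → ℤ) (s : Fin k → ℕ),
    (∀ i, IsGBS α (V i) ∧ (s i = 0 ∨ s i = 1) ∧ StrictMonoOn (V i) (Set.Ici (s i))) ∧
      S = ⋃ i, V i '' Set.Ici (s i)

/-!
Let `x` be the Fibonacci word and `f` its morphism. The occurrences of a factor `w` are, up to a
shift by one letter when `w` begins with `1`, the images under `f` of the occurrences of a shorter
factor. Descending to the empty word, one finds that `x = r σ(x)` for a morphism `σ : 0 ↦ u, 1 ↦ v`,
where `w` occurs exactly at the beginnings of the blocks `σ(x k)`. In the absence of overlaps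
`u = w s` and `v = w t`, so replacing `w` by `2` turns `x` into `r τ(x)` with
`τ : 0 ↦ 2 s, 1 ↦ 2 t`.

The first `n` letters of `x` contain `⌊(n + 1) φ⌋ - (n + 1)` letters `0`. Hence the beginning of the
`n`-th block `τ(0)`, or `τ(1)`, is a generalized Beatty sequence in `n ≥ 1`, and so is the position
of each letter of that block. This accounts for everything but the letters of `r`. The words `r` and
`s` are suffixes of a common word and (SR0) says that `|r| ≤ |s|`; therefore `r` is the end of an
additional block `τ(0)` with index `n = 0`, and the letters of `r` extend the sequences that belong
to `τ(0)`.
-/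

section Occurrences

variable {A : Type*} {x : ℕ → A}

theorem length_wordSegment (x : ℕ → A) (i j : ℕ) : (wordSegment x i j).length = j - i := by
  simp [wordSegment]

theorem occursAt_wordSegment (x : ℕ → A) (i j : ℕ) : OccursAt x (wordSegment x i j) i := by
  simp [OccursAt, wordSegment]

theorem wordSegment_zero_succ (x : ℕ → A) (n : ℕ) :
    wordSegment x 0 (n + 1) = wordSegment x 0 n ++ [x n] := by
  simp [wordSegment, List.range_succ]

theorem count_wordSegment_zero [DecidableEq A] (x : ℕ → A) (a : A) (n : ℕ) :
    (wordSegment x 0 n).count a = Nat.count (fun i => x i = a) n := by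
  induction n with
  | zero => rfl
  | succ n ih =>
    rw [wordSegment_zero_succ, List.count_append, ih, Nat.count_succ, List.count_singleton]
    simp only [beq_iff_eq]

theorem occursAt_iff {w : List A} {i : ℕ} :
    OccursAt x w i ↔ ∀ (j : ℕ) (h : j < w.length), x (i + j) = w[j] := by
  unfold OccursAt wordSegment
  refine ⟨fun h j hj => ?_, fun h => List.ext_getElem (by simp) fun j _ hj => ?_⟩
  · simpa using List.getElem_of_eq h (by simpa using hj)
  · simpa using h j hj

theorem OccursAt.apply_of_getElem?_eq {w : List A} {i j : ℕ} {a : A} (h : OccursAt x w i)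
    (hj : w[j]? = some a) : x (i + j) = a := by
  obtain ⟨hlt, rfl⟩ := List.getElem?_eq_some_iff.1 hj
  exact occursAt_iff.1 h j hlt

theorem occursAt_nil (x : ℕ → A) (i : ℕ) : OccursAt x [] i := by simp [occursAt_iff]

theorem occursAt_append {a b : List A} {i : ℕ} :
    OccursAt x (a ++ b) i ↔ OccursAt x a i ∧ OccursAt x b (i + a.length) := by
  have split : wordSegment x i (i + (a ++ b).length) =
      wordSegment x i (i + a.length) ++
        wordSegment x (i + a.length) (i + a.length + b.length) := by
    simp [wordSegment, List.range_add, Function.comp_def, Nat.add_assoc, Nat.add_sub_add_left]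
  rw [OccursAt, split, List.append_eq_append_iff_of_size_eq_left]
  · rfl
  · simp [length_wordSegment]

theorem occursAt_singleton {a : A} {i : ℕ} : OccursAt x [a] i ↔ x i = a := by
  simp [occursAt_iff]

theorem occursAt_cons {a : A} {l : List A} {i : ℕ} :
    OccursAt x (a :: l) i ↔ x i = a ∧ OccursAt x l (i + 1) := by
  rw [← List.singleton_append, occursAt_append, occursAt_singleton, List.length_singleton]

theorem OccursAt.eq_of_length_eq {a b : List A} {i : ℕ} (ha : OccursAt x a i)
    (hb : OccursAt x b i) (hab : a.length = b.length) : a = b :=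
  ha.symm.trans (hab ▸ hb)

theorem OccursAt.prefix_of_length_le {a b : List A} {i : ℕ} (ha : OccursAt x a i)
    (hb : OccursAt x b i) (hab : a.length ≤ b.length) : a <+: b := by
  rw [← List.take_append_drop a.length b, occursAt_append] at hb
  rw [ha.eq_of_length_eq hb.1 (by simp [hab])]
  exact List.take_prefix _ _

theorem OccursAt.of_prefix {a b : List A} {i : ℕ} (hb : OccursAt x b i) (hab : a <+: b) :
    OccursAt x a i := by
  obtain ⟨t, rfl⟩ := hab
  exact (occursAt_append.1 hb).1

theorem OccursAt.wordSegment_append {l : List A} {i : ℕ} (h : OccursAt x l i) :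
    wordSegment x 0 i ++ l = wordSegment x 0 (i + l.length) := by
  refine OccursAt.eq_of_length_eq (i := 0) (occursAt_append.2 ⟨occursAt_wordSegment x 0 i, ?_⟩)
    (occursAt_wordSegment x 0 _) ?_
  · simpa [length_wordSegment] using h
  · simp [length_wordSegment]

theorem hasOverlap_of_occursAt {w : List A} {i d : ℕ} (h : OccursAt x w i)
    (hshift : OccursAt x w (i + d)) (hd : 0 < d) (hdw : d < w.length) : HasOverlap x w := by
  have hw₁ : w = w.take d ++ w.drop d := (List.take_append_drop d w).symm
  have hw₂ : w = w.take (w.length - d) ++ w.drop (w.length - d) :=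
    (List.take_append_drop _ w).symm
  have hlen₁ : i + d = i + (w.take d).length := by
    rw [List.length_take_of_le hdw.le]
  have hlen₂ : i + w.length = i + d + (w.take (w.length - d)).length := by
    rw [List.length_take_of_le (Nat.sub_le _ _)]
    omega
  have hdrop := (occursAt_append.1 (hw₁ ▸ h)).2
  obtain ⟨htake, hrest⟩ := occursAt_append.1 (hw₂ ▸ hshift)
  have hborder : w.drop d = w.take (w.length - d) :=
    hdrop.eq_of_length_eq (hlen₁ ▸ htake) (by simp)
  refine ⟨w.take d, w.drop d, w.drop (w.length - d), ?_, ?_, ?_, hw₁, hborder ▸ hw₂, i, ?_⟩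
  · exact List.ne_nil_of_length_pos (by simp; omega)
  · exact List.ne_nil_of_length_pos (by simp; omega)
  · exact List.ne_nil_of_length_pos (by simp; omega)
  · rw [← hw₁, occursAt_append]
    exact ⟨h, hlen₂ ▸ hrest⟩

end Occurrences

section FibonacciMorphism

theorem fibMorphism_cons (a : ℕ) (l : List ℕ) :
    fibMorphism (a :: l) = (if a = 0 then [0, 1] else [0]) ++ fibMorphism l :=
  rfl

theorem fibMorphism_append (l m : List ℕ) :
    fibMorphism (l ++ m) = fibMorphism l ++ fibMorphism m :=
  List.flatMap_append

theorem fibMorphism_ne_nil {l : List ℕ} (h : l ≠ []) : fibMorphism l ≠ [] := by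
  obtain ⟨a, l, rfl⟩ := List.exists_cons_of_ne_nil h
  rw [fibMorphism_cons]
  split_ifs <;> simp

theorem length_fibMorphism (l : List ℕ) : (fibMorphism l).length = l.length + l.count 0 := by
  induction l with
  | nil => rfl
  | cons a l ih =>
    rw [fibMorphism_cons, List.length_append, ih]
    grind

theorem fibMorphism_iterate_prefix_succ (n : ℕ) :
    fibMorphism^[n] [0] <+: fibMorphism^[n + 1] [0] := by
  induction n with
  | zero => exact ⟨[1], rfl⟩
  | succ n ih =>
    rw [Function.iterate_succ_apply', Function.iterate_succ_apply' fibMorphism (n + 1)]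
    exact ih.flatMap _

theorem fibMorphism_iterate_prefix {m n : ℕ} (h : m ≤ n) :
    fibMorphism^[m] [0] <+: fibMorphism^[n] [0] :=
  Nat.rel_of_forall_rel_succ_of_le (· <+: ·) fibMorphism_iterate_prefix_succ h

theorem lt_length_fibMorphism_iterate (n : ℕ) : n < (fibMorphism^[n] [0]).length := by
  induction n with
  | zero => simp
  | succ n ih =>
    have hzero : 0 < (fibMorphism^[n] [0]).count 0 :=
      List.count_pos_iff.2 ((fibMorphism_iterate_prefix n.zero_le).subset (by simp))
    rw [Function.iterate_succ_apply', length_fibMorphism]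
    omega

theorem occursAt_fibMorphism_iterate (n : ℕ) : OccursAt fibWord (fibMorphism^[n] [0]) 0 := by
  refine occursAt_iff.2 fun j hj => ?_
  have hj' := lt_length_fibMorphism_iterate j
  rw [zero_add, fibWord, List.getD_eq_getElem _ _ hj']
  rcases le_total n j with h | h
  · exact ((fibMorphism_iterate_prefix h).getElem hj).symm
  · exact (fibMorphism_iterate_prefix h).getElem hj'

theorem OccursAt.fibMorphism_zero {l : List ℕ} (h : OccursAt fibWord l 0) :
    OccursAt fibWord (fibMorphism l) 0 := by
  have hl : l <+: fibMorphism^[l.length] [0] :=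
    h.prefix_of_length_le (occursAt_fibMorphism_iterate _) (lt_length_fibMorphism_iterate _).le
  have hf : fibMorphism l <+: fibMorphism^[l.length + 1] [0] := by
    rw [Function.iterate_succ_apply']
    exact hl.flatMap _
  exact (occursAt_fibMorphism_iterate _).of_prefix hf

theorem fibWord_zero : fibWord 0 = 0 := rfl

/-- The number of letters `0` among the first `n` letters of the Fibonacci word. -/
def fibZeros (n : ℕ) : ℕ := Nat.count (fun i => fibWord i = 0) n

theorem fibZeros_zero : fibZeros 0 = 0 := rfl

theorem fibZeros_succ (n : ℕ) :
    fibZeros (n + 1) = fibZeros n + if fibWord n = 0 then 1 else 0 :=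
  Nat.count_succ _ n

theorem fibZeros_pos {n : ℕ} (hn : 0 < n) : 0 < fibZeros n :=
  Nat.pos_of_ne_zero (Nat.count_ne_iff_exists.2 ⟨0, hn, fibWord_zero⟩)

/-- The index at which the image `f(x n)` of the letter with index `n` begins in
`x = f(x 0) f(x 1) …`, where `x` is the Fibonacci word and `f` the Fibonacci morphism: the image of
`0` has two letters and the image of `1` has one. -/
def fibImageStart (n : ℕ) : ℕ := n + fibZeros n

theorem length_fibMorphism_wordSegment (n : ℕ) :
    (fibMorphism (wordSegment fibWord 0 n)).length = fibImageStart n := by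
  rw [length_fibMorphism, length_wordSegment, count_wordSegment_zero]
  rfl

theorem OccursAt.fibMorphism_fibImageStart {l : List ℕ} {i : ℕ} (h : OccursAt fibWord l i) :
    OccursAt fibWord (fibMorphism l) (fibImageStart i) := by
  have hprefix : OccursAt fibWord (wordSegment fibWord 0 i ++ l) 0 := by
    rw [h.wordSegment_append]
    exact occursAt_wordSegment _ _ _
  have himage := hprefix.fibMorphism_zero
  rw [fibMorphism_append, occursAt_append, length_fibMorphism_wordSegment, zero_add] at himage
  exact himage.2

theorem OccursAt.fibImageStart_add_length {l : List ℕ} {i : ℕ} (h : OccursAt fibWord l i) :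
    fibImageStart (i + l.length) = fibImageStart i + (fibMorphism l).length := by
  rw [← length_fibMorphism_wordSegment, ← h.wordSegment_append, fibMorphism_append,
    List.length_append, length_fibMorphism_wordSegment]

theorem fibImageStart_succ_of_eq_zero {n : ℕ} (hn : fibWord n = 0) :
    fibImageStart (n + 1) = fibImageStart n + 2 := by
  rw [fibImageStart, fibZeros_succ, if_pos hn, fibImageStart]
  omega

theorem fibImageStart_succ_of_ne_zero {n : ℕ} (hn : fibWord n ≠ 0) :
    fibImageStart (n + 1) = fibImageStart n + 1 := by
  rw [fibImageStart, fibZeros_succ, if_neg hn, fibImageStart]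
  omega

theorem fibImageStart_strictMono : StrictMono fibImageStart :=
  strictMono_nat_of_lt_succ fun n => by
    by_cases hn : fibWord n = 0
    · rw [fibImageStart_succ_of_eq_zero hn]
      omega
    · rw [fibImageStart_succ_of_ne_zero hn]
      omega

theorem fibWord_fibImageStart (n : ℕ) : fibWord (fibImageStart n) = 0 := by
  have h := (occursAt_singleton.2 (rfl : fibWord n = _)).fibMorphism_fibImageStart
  rw [fibMorphism_cons] at h
  split_ifs at h <;> exact (occursAt_cons.1 h).1

theorem fibWord_fibImageStart_add_one_of_eq_zero {n : ℕ} (hn : fibWord n = 0) :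
    fibWord (fibImageStart n + 1) = 1 :=
  (occursAt_cons.1 (occursAt_cons.1 (occursAt_singleton.2 hn).fibMorphism_fibImageStart).2).1

theorem fibWord_fibImageStart_add_one_eq_zero_iff {n : ℕ} :
    fibWord (fibImageStart n + 1) = 0 ↔ fibWord n ≠ 0 := by
  refine ⟨fun h hn => ?_, fun hn => ?_⟩
  · rw [fibWord_fibImageStart_add_one_of_eq_zero hn] at h
    exact one_ne_zero h
  · rw [← fibImageStart_succ_of_ne_zero hn]
    exact fibWord_fibImageStart _

theorem exists_fibImageStart (i : ℕ) :
    ∃ n, i = fibImageStart n ∨ (i = fibImageStart n + 1 ∧ fibWord n = 0) := by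
  induction i with
  | zero => exact ⟨0, Or.inl rfl⟩
  | succ i ih =>
    obtain ⟨n, rfl | ⟨rfl, hn⟩⟩ := ih
    · by_cases hn : fibWord n = 0
      · exact ⟨n, Or.inr ⟨rfl, hn⟩⟩
      · exact ⟨n + 1, Or.inl (fibImageStart_succ_of_ne_zero hn).symm⟩
    · exact ⟨n + 1, Or.inl (fibImageStart_succ_of_eq_zero hn).symm⟩

theorem fibWord_eq_zero_or_one (i : ℕ) : fibWord i = 0 ∨ fibWord i = 1 := by
  obtain ⟨n, rfl | ⟨rfl, hn⟩⟩ := exists_fibImageStart i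
  · exact Or.inl (fibWord_fibImageStart n)
  · exact Or.inr (fibWord_fibImageStart_add_one_of_eq_zero hn)

theorem fibWord_ne_zero_iff {i : ℕ} : fibWord i ≠ 0 ↔ fibWord i = 1 := by
  have := fibWord_eq_zero_or_one i
  omega

theorem fibWord_eq_zero_iff {i : ℕ} : fibWord i = 0 ↔ ∃ n, i = fibImageStart n := by
  refine ⟨fun h => ?_, ?_⟩
  · obtain ⟨n, hn | ⟨rfl, hn⟩⟩ := exists_fibImageStart i
    · exact ⟨n, hn⟩
    · exact absurd hn (fibWord_fibImageStart_add_one_eq_zero_iff.1 h)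
  · rintro ⟨n, rfl⟩
    exact fibWord_fibImageStart n

theorem fibWord_eq_one_iff {i : ℕ} :
    fibWord i = 1 ↔ ∃ n, i = fibImageStart (fibImageStart n) + 1 := by
  refine ⟨fun h => ?_, ?_⟩
  · obtain ⟨n, rfl | ⟨rfl, hn⟩⟩ := exists_fibImageStart i
    · exact absurd (fibWord_fibImageStart n) (fibWord_ne_zero_iff.2 h)
    · obtain ⟨m, rfl⟩ := fibWord_eq_zero_iff.1 hn
      exact ⟨m, rfl⟩
  · rintro ⟨n, rfl⟩
    exact fibWord_fibImageStart_add_one_of_eq_zero (fibWord_fibImageStart n)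

theorem fibWord_succ_eq_zero {i : ℕ} (h : fibWord i = 1) : fibWord (i + 1) = 0 := by
  obtain ⟨n, rfl⟩ := fibWord_eq_one_iff.1 h
  exact fibWord_eq_zero_iff.2
    ⟨_, (fibImageStart_succ_of_eq_zero (fibWord_fibImageStart n)).symm⟩

theorem exists_succ_eq_of_fibWord_eq_one {i : ℕ} (h : fibWord i = 1) :
    ∃ n, fibWord n = 0 ∧ i = n + 1 := by
  obtain ⟨n, rfl⟩ := fibWord_eq_one_iff.1 h
  exact ⟨_, fibWord_fibImageStart _, rfl⟩

end FibonacciMorphism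

section Desubstitution

/-- The word `l` is a desubstitution of `w` under the Fibonacci morphism: in the Fibonacci word, the
occurrences of `w` are exactly the images of the occurrences of `l`. -/
def IsDesubstitution (l w : List ℕ) : Prop :=
  ∀ i, OccursAt fibWord w i ↔ ∃ n, OccursAt fibWord l n ∧ i = fibImageStart n

theorem isDesubstitution_zero_cons_iff {l t : List ℕ} :
    IsDesubstitution l (0 :: t) ↔
      ∀ n, OccursAt fibWord (0 :: t) (fibImageStart n) ↔ OccursAt fibWord l n := by
  refine ⟨fun h n => (h _).trans ⟨?_, fun hn => ⟨n, hn, rfl⟩⟩, fun h i => ⟨fun hi => ?_, ?_⟩⟩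
  · rintro ⟨m, hm, hnm⟩
    rwa [fibImageStart_strictMono.injective hnm]
  · obtain ⟨n, rfl⟩ := fibWord_eq_zero_iff.1 (occursAt_cons.1 hi).1
    exact ⟨n, (h n).1 hi, rfl⟩
  · rintro ⟨n, hn, rfl⟩
    exact (h n).2 hn

theorem isDesubstitution_singleton_zero : IsDesubstitution [] [0] :=
  isDesubstitution_zero_cons_iff.2 fun n => by
    simp only [occursAt_singleton, fibWord_fibImageStart, occursAt_nil]

theorem isDesubstitution_zero_one : IsDesubstitution [0] [0, 1] :=
  isDesubstitution_zero_cons_iff.2 fun n => by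
    rw [occursAt_cons, occursAt_singleton, occursAt_singleton, ← fibWord_ne_zero_iff, Ne,
      fibWord_fibImageStart_add_one_eq_zero_iff, not_not]
    exact and_iff_right (fibWord_fibImageStart n)

theorem IsDesubstitution.one_cons {l t : List ℕ} (h : IsDesubstitution l (0 :: t)) :
    IsDesubstitution (1 :: l) (0 :: 0 :: t) := by
  refine isDesubstitution_zero_cons_iff.2 fun n => ?_
  rw [occursAt_cons (l := 0 :: t), occursAt_cons (l := l), ← fibWord_ne_zero_iff,
    and_iff_right (fibWord_fibImageStart n), ← isDesubstitution_zero_cons_iff.1 h]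
  by_cases hn : fibWord n = 0
  · have hone : fibWord (fibImageStart n + 1) ≠ 0 :=
      fibWord_fibImageStart_add_one_eq_zero_iff.not_left.2 hn
    simp only [occursAt_cons, hone, hn, ne_eq, not_true, false_and]
  · rw [fibImageStart_succ_of_ne_zero hn, and_iff_right hn]

theorem IsDesubstitution.zero_cons {l t : List ℕ} (h : IsDesubstitution l (0 :: t)) :
    IsDesubstitution (0 :: l) (0 :: 1 :: 0 :: t) := by
  refine isDesubstitution_zero_cons_iff.2 fun n => ?_
  rw [occursAt_cons (l := 1 :: 0 :: t), occursAt_cons (l := 0 :: t), occursAt_cons (l := l),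
    and_iff_right (fibWord_fibImageStart n), ← isDesubstitution_zero_cons_iff.1 h,
    ← fibWord_ne_zero_iff, Ne, fibWord_fibImageStart_add_one_eq_zero_iff, not_not]
  refine and_congr_right fun hn => ?_
  rw [fibImageStart_succ_of_eq_zero hn]

theorem exists_isDesubstitution : ∀ t : List ℕ, IsFactor fibWord (0 :: t) →
    ∃ l, IsDesubstitution l (0 :: t) ∧ l.length ≤ t.length ∧
      (t.head? = some 1 → l.head? = some 0)
  | [], _ => ⟨[], isDesubstitution_singleton_zero, le_rfl, by simp⟩
  | a :: t, ⟨i, hi⟩ => by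
    have hat := (occursAt_cons.1 hi).2
    obtain rfl | rfl : a = 0 ∨ a = 1 := (occursAt_cons.1 hat).1 ▸ fibWord_eq_zero_or_one (i + 1)
    · obtain ⟨l, hl, hlen, -⟩ := exists_isDesubstitution t ⟨i + 1, hat⟩
      exact ⟨1 :: l, hl.one_cons, by simpa using hlen, by simp⟩
    · obtain ⟨hone, ht⟩ := occursAt_cons.1 hat
      obtain _ | ⟨b, s⟩ := t
      · exact ⟨[0], isDesubstitution_zero_one, by simp, by simp⟩
      · obtain rfl : b = 0 := (occursAt_cons.1 ht).1 ▸ fibWord_succ_eq_zero hone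
        obtain ⟨l, hl, hlen, -⟩ := exists_isDesubstitution s ⟨i + 1 + 1, ht⟩
        exact ⟨0 :: l, hl.zero_cons, by simp only [List.length_cons]; omega, by simp⟩

theorem occursAt_one_cons_iff {t : List ℕ} {i : ℕ} :
    OccursAt fibWord (1 :: t) i ↔ ∃ n, OccursAt fibWord (0 :: 1 :: t) n ∧ i = n + 1 := by
  refine ⟨fun h => ?_, ?_⟩
  · obtain ⟨n, hn, rfl⟩ := exists_succ_eq_of_fibWord_eq_one (occursAt_cons.1 h).1
    exact ⟨n, occursAt_cons.2 ⟨hn, h⟩, rfl⟩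
  · rintro ⟨n, hn, rfl⟩
    exact (occursAt_cons.1 hn).2

end Desubstitution

section FibonacciConcatenation

variable {A B : Type*}

/-- The block `σ(x k)` of the image of the Fibonacci word `x` under the morphism
`σ : 0 ↦ u, 1 ↦ v`. -/
def fibBlock (u v : List A) (k : ℕ) : List A :=
  if fibWord k = 0 then u else v

theorem apply_fibBlock (g : List A → List B) (u v : List A) (k : ℕ) :
    g (fibBlock u v k) = fibBlock (g u) (g v) k :=
  apply_ite g _ _ _

theorem fibBlock_of_eq_zero {k : ℕ} (hk : fibWord k = 0) (u v : List A) : fibBlock u v k = u :=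
  if_pos hk

theorem fibBlock_of_eq_one {k : ℕ} (hk : fibWord k = 1) (u v : List A) : fibBlock u v k = v :=
  if_neg (fibWord_ne_zero_iff.2 hk)

theorem fibBlock_ne_nil {u v : List A} (hu : u ≠ []) (hv : v ≠ []) (k : ℕ) :
    fibBlock u v k ≠ [] := by
  unfold fibBlock
  split_ifs <;> assumption

/-- The index at which the block `σ(x k)` begins in the infinite word `r σ(x 0) σ(x 1) …`, where `x`
is the Fibonacci word and `σ : 0 ↦ u, 1 ↦ v`. -/
def blockStart (r u v : List A) : ℕ → ℕ
  | 0 => r.length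
  | k + 1 => blockStart r u v k + (fibBlock u v k).length

theorem blockStart_zero (r u v : List A) : blockStart r u v 0 = r.length := rfl

theorem blockStart_succ (r u v : List A) (k : ℕ) :
    blockStart r u v (k + 1) = blockStart r u v k + (fibBlock u v k).length := rfl

theorem blockStart_strictMono (r : List A) {u v : List A} (hu : u ≠ []) (hv : v ≠ []) :
    StrictMono (blockStart r u v) :=
  strictMono_nat_of_lt_succ fun k =>
    Nat.lt_add_of_pos_right (List.length_pos_of_ne_nil (fibBlock_ne_nil hu hv k))

theorem blockStart_append_singleton (r u v : List A) (a : A) (k : ℕ) :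
    blockStart (r ++ [a]) (u ++ [a]) (v ++ [a]) k = blockStart r (a :: u) (a :: v) k + 1 := by
  induction k with
  | zero => simp [blockStart]
  | succ k ih =>
    rw [blockStart_succ, blockStart_succ, ih, ← apply_fibBlock (· ++ [a]),
      ← apply_fibBlock (a :: ·)]
    simp only [List.length_append, List.length_cons, List.length_nil]
    omega

theorem exists_mem_block {r u v : List A} (hu : u ≠ []) (hv : v ≠ []) {n : ℕ}
    (hn : r.length ≤ n) :
    ∃ k j, n = blockStart r u v k + j ∧ j < (fibBlock u v k).length := by
  induction n, hn using Nat.le_induction with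
  | base => exact ⟨0, 0, rfl, List.length_pos_of_ne_nil (fibBlock_ne_nil hu hv 0)⟩
  | succ n _ ih =>
    obtain ⟨k, j, rfl, hj⟩ := ih
    rcases Nat.lt_or_eq_of_le (Nat.succ_le_of_lt hj) with hj' | hj'
    · exact ⟨k, j + 1, rfl, hj'⟩
    · exact ⟨k + 1, 0, by rw [blockStart_succ]; omega,
        List.length_pos_of_ne_nil (fibBlock_ne_nil hu hv _)⟩

/-- The infinite word `y` is `r σ(x)`, where `x` is the Fibonacci word and `σ` is the morphism
`0 ↦ u, 1 ↦ v`. -/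
structure IsFibConcat (y : ℕ → A) (r u v : List A) : Prop where
  occursAt_prefix : OccursAt y r 0
  occursAt_block : ∀ k, OccursAt y (fibBlock u v k) (blockStart r u v k)

theorem IsFibConcat.append_singleton {y : ℕ → A} {r u v : List A} {a : A}
    (h : IsFibConcat y r (a :: u) (a :: v)) :
    IsFibConcat y (r ++ [a]) (u ++ [a]) (v ++ [a]) := by
  have hblock (k : ℕ) : y (blockStart r (a :: u) (a :: v) k) = a ∧
      OccursAt y (fibBlock u v k) (blockStart r (a :: u) (a :: v) k + 1) := by
    have := h.occursAt_block k
    rwa [← apply_fibBlock (a :: ·), occursAt_cons] at this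
  refine ⟨occursAt_append.2 ⟨h.occursAt_prefix, ?_⟩, fun k => ?_⟩
  · simpa [occursAt_singleton, blockStart_zero] using (hblock 0).1
  · rw [← apply_fibBlock (· ++ [a]), blockStart_append_singleton, occursAt_append,
      occursAt_singleton]
    refine ⟨(hblock k).2, ?_⟩
    have hnext := (hblock (k + 1)).1
    rwa [blockStart_succ, ← apply_fibBlock (a :: ·), List.length_cons, ← add_assoc,
      add_right_comm] at hnext

theorem IsFibConcat.fibImageStart_blockStart {r u v : List ℕ} (h : IsFibConcat fibWord r u v)
    (k : ℕ) : fibImageStart (blockStart r u v k) =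
      blockStart (fibMorphism r) (fibMorphism u) (fibMorphism v) k := by
  induction k with
  | zero =>
    have := h.occursAt_prefix.fibImageStart_add_length
    rwa [zero_add, show fibImageStart 0 = 0 from rfl, zero_add] at this
  | succ k ih =>
    rw [blockStart_succ, blockStart_succ, (h.occursAt_block k).fibImageStart_add_length, ih,
      apply_fibBlock fibMorphism]

theorem IsFibConcat.map_fibMorphism {r u v : List ℕ} (h : IsFibConcat fibWord r u v) :
    IsFibConcat fibWord (fibMorphism r) (fibMorphism u) (fibMorphism v) where
  occursAt_prefix := h.occursAt_prefix.fibMorphism_zero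
  occursAt_block k := by
    rw [← apply_fibBlock fibMorphism, ← h.fibImageStart_blockStart]
    exact (h.occursAt_block k).fibMorphism_fibImageStart

theorem blockStart_nil_zero_one (n : ℕ) : blockStart [] [0] [1] n = n := by
  induction n with
  | zero => rfl
  | succ n ih =>
    rw [blockStart_succ, ih, fibBlock]
    split_ifs <;> rfl

theorem isFibConcat_fibWord : IsFibConcat fibWord [] [0] [1] where
  occursAt_prefix := occursAt_nil _ _
  occursAt_block k := by
    rw [blockStart_nil_zero_one]
    rcases fibWord_eq_zero_or_one k with h | h
    · rwa [fibBlock_of_eq_zero h, occursAt_singleton]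
    · rwa [fibBlock_of_eq_one h, occursAt_singleton]

end FibonacciConcatenation

section ReturnDecomposition

/-- The decomposition `r σ(x)` of the Fibonacci word `x` by the occurrences of `w`, for the morphism
`σ : 0 ↦ u, 1 ↦ v`: the blocks `σ(x k)` are the return words of `w`, so that `u = r₁(w)`, and
`r = r₀(w)`. That `r` and `u` are suffixes of a common word `W` is what allows one to regard `r`, as
soon as it is short enough, as the end of an additional block `u`. -/
structure IsReturnDecomposition (w r u v : List ℕ) : Prop extends
    IsFibConcat fibWord r u v where
  left_ne_nil : u ≠ []
  right_ne_nil : v ≠ []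
  occursAt_iff : ∀ i, OccursAt fibWord w i ↔ ∃ k, blockStart r u v k = i
  exists_suffix : ∃ W, r <:+ W ∧ u <:+ W

namespace IsReturnDecomposition

variable {w r u v : List ℕ}

theorem occursAt_blockStart (h : IsReturnDecomposition w r u v) (k : ℕ) :
    OccursAt fibWord w (blockStart r u v k) :=
  (h.occursAt_iff _).2 ⟨k, rfl⟩

theorem desubstitute (h : IsReturnDecomposition w r u v) {l : List ℕ}
    (hl : IsDesubstitution w l) :
    IsReturnDecomposition l (fibMorphism r) (fibMorphism u) (fibMorphism v) where
  toIsFibConcat := h.map_fibMorphism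
  left_ne_nil := fibMorphism_ne_nil h.left_ne_nil
  right_ne_nil := fibMorphism_ne_nil h.right_ne_nil
  occursAt_iff i := by
    rw [hl i]
    simp only [h.occursAt_iff, ← h.fibImageStart_blockStart, exists_exists_eq_and]
    exact exists_congr fun _ => eq_comm
  exists_suffix := by
    obtain ⟨W, hr, hu⟩ := h.exists_suffix
    exact ⟨fibMorphism W, hr.flatMap _, hu.flatMap _⟩

theorem exists_eq_cons {a : ℕ} (h : IsReturnDecomposition (a :: w) r u v) :
    (∃ u', u = a :: u') ∧ ∃ v', v = a :: v' := by
  have hblock (k : ℕ) : ∃ l, fibBlock u v k = a :: l := by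
    obtain ⟨b, l, hbl⟩ := List.exists_cons_of_ne_nil
      (fibBlock_ne_nil h.left_ne_nil h.right_ne_nil k)
    have hb := h.occursAt_block k
    rw [hbl] at hb
    exact ⟨l, by rw [hbl, ← (occursAt_cons.1 hb).1, (occursAt_cons.1 (h.occursAt_blockStart k)).1]⟩
  exact ⟨hblock 0, hblock 1⟩

theorem tail {a : ℕ} (h : IsReturnDecomposition (a :: w) r (a :: u) (a :: v))
    (hw : ∀ i, OccursAt fibWord w i ↔ ∃ n, OccursAt fibWord (a :: w) n ∧ i = n + 1) :
    IsReturnDecomposition w (r ++ [a]) (u ++ [a]) (v ++ [a]) where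
  toIsFibConcat := h.append_singleton
  left_ne_nil := by simp
  right_ne_nil := by simp
  occursAt_iff i := by
    rw [hw i]
    simp only [h.occursAt_iff, blockStart_append_singleton, exists_exists_eq_and]
    exact exists_congr fun _ => eq_comm
  exists_suffix := by
    obtain ⟨W, ⟨r', rfl⟩, ⟨u', hu⟩⟩ := h.exists_suffix
    exact ⟨r' ++ r ++ [a], ⟨r', by simp⟩, ⟨u' ++ [a], by simp [← hu]⟩⟩

end IsReturnDecomposition

theorem isReturnDecomposition_nil : IsReturnDecomposition [] [] [0] [1] where
  toIsFibConcat := isFibConcat_fibWord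
  left_ne_nil := by simp
  right_ne_nil := by simp
  occursAt_iff i := by
    simp only [occursAt_nil, blockStart_nil_zero_one, exists_eq]
  exists_suffix := ⟨[0], List.nil_suffix, List.suffix_rfl⟩

theorem exists_isReturnDecomposition {w : List ℕ} (hw : IsFactor fibWord w) :
    ∃ r u v, IsReturnDecomposition w r u v := by
  -- A leading `1` weighs half a letter: `1…` has to be completed to `01…` before desubstitution.
  induction hweight : 2 * w.length + (if w.head? = some 1 then 1 else 0)
    using Nat.strong_induction_on generalizing w with | _ N ih
  obtain ⟨i, hi⟩ := hw
  obtain _ | ⟨a, t⟩ := w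
  · exact ⟨_, _, _, isReturnDecomposition_nil⟩
  obtain rfl | rfl : a = 0 ∨ a = 1 := (occursAt_cons.1 hi).1 ▸ fibWord_eq_zero_or_one i
  · obtain ⟨l, hl, hlen, -⟩ := exists_isDesubstitution t ⟨i, hi⟩
    obtain ⟨n, hn, -⟩ := (hl i).1 hi
    obtain ⟨r, u, v, h⟩ := ih _ (by subst hweight; grind) ⟨n, hn⟩ rfl
    exact ⟨_, _, _, h.desubstitute hl⟩
  · obtain ⟨m, hm, -⟩ := occursAt_one_cons_iff.1 hi
    obtain ⟨l, hl, hlen, hhead⟩ := exists_isDesubstitution (1 :: t) ⟨m, hm⟩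
    obtain ⟨n, hn, -⟩ := (hl m).1 hm
    obtain ⟨r, u, v, h⟩ := ih _ (by subst hweight; grind) ⟨n, hn⟩ rfl
    have h' := h.desubstitute hl
    obtain ⟨⟨u', hu⟩, v', hv⟩ := h'.exists_eq_cons
    rw [hu, hv] at h'
    exact ⟨_, _, _, h'.tail fun i => occursAt_one_cons_iff⟩

end ReturnDecomposition

section GoldenRatio

open Real

theorem fibZeros_fibImageStart (n : ℕ) : fibZeros (fibImageStart n) = n := by
  induction n with
  | zero => rfl
  | succ n ih =>
    by_cases hn : fibWord n = 0
    · rw [fibImageStart_succ_of_eq_zero hn, fibZeros_succ, fibZeros_succ, ih,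
        if_pos (fibWord_fibImageStart n),
        if_neg (fibWord_fibImageStart_add_one_eq_zero_iff.not_left.2 hn)]
    · rw [fibImageStart_succ_of_ne_zero hn, fibZeros_succ, ih, if_pos (fibWord_fibImageStart n)]

theorem fibZeros_fibImageStart_add_one (n : ℕ) : fibZeros (fibImageStart n + 1) = n + 1 := by
  rw [fibZeros_succ, fibZeros_fibImageStart, if_pos (fibWord_fibImageStart n)]

theorem fibZeros_mul_goldenRatio_bounds (n : ℕ) :
    fibZeros n * goldenRatio < n + 1 ∧ (n + 1 : ℝ) < (fibZeros n + 1) * goldenRatio := by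
  have hφ := one_lt_goldenRatio
  have hφ_sq := goldenRatio_sq
  induction n using Nat.strong_induction_on with | _ n ih
  obtain rfl | hn := Nat.eq_zero_or_pos n
  · simp [fibZeros_zero, hφ]
  obtain ⟨m, rfl | ⟨rfl, -⟩⟩ := exists_fibImageStart n
  · have hm : m < fibImageStart m := by
      obtain rfl | hpos := Nat.eq_zero_or_pos m
      · exact hn
      · exact Nat.lt_add_of_pos_right (fibZeros_pos hpos)
    obtain ⟨hlower, hupper⟩ := ih m hm
    rw [fibZeros_fibImageStart, fibImageStart]
    push_cast
    constructor <;> nlinarith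
  · obtain ⟨hlower, hupper⟩ := ih m (Nat.lt_succ_of_le (Nat.le_add_right _ _))
    rw [fibZeros_fibImageStart_add_one, fibImageStart]
    push_cast
    constructor <;> nlinarith

theorem floor_add_one_mul_goldenRatio (n : ℕ) :
    ⌊((n + 1 : ℕ) : ℝ) * goldenRatio⌋ = (n : ℤ) + 1 + fibZeros n := by
  have hφ_sq := goldenRatio_sq
  obtain ⟨hlower, hupper⟩ := fibZeros_mul_goldenRatio_bounds n
  rw [Int.floor_eq_iff]
  push_cast
  constructor <;> nlinarith [one_lt_goldenRatio]

theorem blockStart_fibImageStart {A : Type*} (r u v : List A) (n : ℕ) :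
    blockStart r u v (fibImageStart n) =
      r.length + n * u.length + fibZeros n * v.length := by
  induction n with
  | zero => simp [fibImageStart, fibZeros_zero, blockStart_zero]
  | succ n ih =>
    by_cases hn : fibWord n = 0
    · rw [fibImageStart_succ_of_eq_zero hn, blockStart_succ, blockStart_succ, ih,
        fibBlock_of_eq_zero (fibWord_fibImageStart n),
        fibBlock_of_eq_one (fibWord_fibImageStart_add_one_of_eq_zero hn), fibZeros_succ, if_pos hn]
      ring
    · rw [fibImageStart_succ_of_ne_zero hn, blockStart_succ, ih,
        fibBlock_of_eq_zero (fibWord_fibImageStart n), fibZeros_succ, if_neg hn]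
      ring

theorem blockStart_fibImageStart_fibImageStart_add_one {A : Type*} (r u v : List A) (n : ℕ) :
    blockStart r u v (fibImageStart (fibImageStart n) + 1) =
      r.length + (n + fibZeros n + 1) * u.length + n * v.length := by
  rw [blockStart_succ, blockStart_fibImageStart, fibZeros_fibImageStart,
    fibBlock_of_eq_zero (fibWord_fibImageStart _), fibImageStart]
  ring

end GoldenRatio

section BeattySequences

variable {α : ℝ}

/-- The generalized Beatty sequence `p⌊nα⌋ + qn + r`. -/
noncomputable def generalizedBeatty (α : ℝ) (p q r : ℤ) (n : ℕ) : ℤ :=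
  p * ⌊(n : ℝ) * α⌋ + q * n + r

theorem isGBS_generalizedBeatty (α : ℝ) (p q r : ℤ) : IsGBS α (generalizedBeatty α p q r) :=
  ⟨p, q, r, fun _ => rfl⟩

theorem generalizedBeatty_zero (α : ℝ) (p q r : ℤ) : generalizedBeatty α p q r 0 = r := by
  simp [generalizedBeatty]

theorem strictMono_generalizedBeatty (hα : 1 ≤ α) {p q : ℤ} (r : ℤ) (hp : 0 ≤ p)
    (hpq : 0 < p + q) : StrictMono (generalizedBeatty α p q r) := by
  refine strictMono_nat_of_lt_succ fun n => ?_
  have hfloor : ⌊(n : ℝ) * α⌋ + 1 ≤ ⌊((n + 1 : ℕ) : ℝ) * α⌋ := by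
    rw [← Int.floor_add_one, Nat.cast_succ, add_one_mul]
    gcongr
  have hmul := mul_le_mul_of_nonneg_left hfloor hp
  unfold generalizedBeatty
  push_cast at hmul ⊢
  linarith

theorem isFiniteUnionGBS_image_Ici {V : ℕ → ℤ} (hV : IsGBS α V) (hmono : StrictMono V) {s : ℕ}
    (hs : s = 0 ∨ s = 1) : IsFiniteUnionGBS α (V '' Set.Ici s) :=
  ⟨1, fun _ => V, fun _ => s, fun _ => ⟨hV, hs, hmono.strictMonoOn _⟩,
    (Set.iUnion_const _).symm⟩

theorem isFiniteUnionGBS_iUnion {ι : Type*} [Finite ι] {S : ι → Set ℤ}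
    (h : ∀ i, IsFiniteUnionGBS α (S i)) : IsFiniteUnionGBS α (⋃ i, S i) := by
  choose k V s hVs hS using h
  obtain ⟨N, ⟨e⟩⟩ := Finite.exists_equiv_fin (Σ i, Fin (k i))
  refine ⟨N, fun n => V _ (e.symm n).2, fun n => s _ (e.symm n).2, fun n => hVs _ _, ?_⟩
  rw [e.symm.surjective.iUnion_comp fun p : Σ i, Fin (k i) => V p.1 p.2 '' Set.Ici (s p.1 p.2),
    Set.iUnion_sigma]
  exact Set.iUnion_congr hS

theorem isFiniteUnionGBS_biUnion {ι : Type*} {T : Set ι} (hT : T.Finite) {S : ι → Set ℤ}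
    (h : ∀ i ∈ T, IsFiniteUnionGBS α (S i)) : IsFiniteUnionGBS α (⋃ i ∈ T, S i) := by
  have := hT.to_subtype
  rw [Set.biUnion_eq_iUnion]
  exact isFiniteUnionGBS_iUnion fun i => h i i.2

theorem IsFiniteUnionGBS.union {S T : Set ℤ} (hS : IsFiniteUnionGBS α S)
    (hT : IsFiniteUnionGBS α T) : IsFiniteUnionGBS α (S ∪ T) := by
  rw [Set.union_eq_iUnion]
  exact isFiniteUnionGBS_iUnion (Bool.rec hT hS)

end BeattySequences

section LetterPositions

open Real

variable {A : Type*} {y : ℕ → A} {r u v z : List A}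

theorem IsFibConcat.apply_eq_iff (h : IsFibConcat y r u v) (hu : u ≠ []) (hv : v ≠ []) {n : ℕ}
    {a : A} : y n = a ↔ r[n]? = some a ∨
      (∃ j, u[j]? = some a ∧ ∃ m, n = blockStart r u v (fibImageStart m) + j) ∨
      ∃ j, v[j]? = some a ∧
        ∃ m, n = blockStart r u v (fibImageStart (fibImageStart m) + 1) + j := by
  have hzero (m : ℕ) : OccursAt y u (blockStart r u v (fibImageStart m)) := by
    simpa only [fibBlock_of_eq_zero (fibWord_fibImageStart m)] using
      h.occursAt_block (fibImageStart m)
  have hone (m : ℕ) : OccursAt y v (blockStart r u v (fibImageStart (fibImageStart m) + 1)) := by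
    simpa only [fibBlock_of_eq_one (fibWord_eq_one_iff.2 ⟨m, rfl⟩)] using
      h.occursAt_block (fibImageStart (fibImageStart m) + 1)
  constructor
  · rintro rfl
    rcases lt_or_ge n r.length with hn | hn
    · left
      rw [List.getElem?_eq_getElem hn, ← occursAt_iff.1 h.occursAt_prefix n hn, zero_add]
    obtain ⟨k, j, rfl, hj⟩ := exists_mem_block hu hv hn
    right
    rcases fibWord_eq_zero_or_one k with hk | hk
    · rw [fibBlock_of_eq_zero hk] at hj
      obtain ⟨m, rfl⟩ := fibWord_eq_zero_iff.1 hk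
      exact Or.inl ⟨j, by rw [occursAt_iff.1 (hzero m) j hj, List.getElem?_eq_getElem], m, rfl⟩
    · rw [fibBlock_of_eq_one hk] at hj
      obtain ⟨m, rfl⟩ := fibWord_eq_one_iff.1 hk
      exact Or.inr ⟨j, by rw [occursAt_iff.1 (hone m) j hj, List.getElem?_eq_getElem], m, rfl⟩
  · rintro (hr | ⟨j, hj, m, rfl⟩ | ⟨j, hj, m, rfl⟩)
    · simpa only [zero_add] using h.occursAt_prefix.apply_of_getElem?_eq hr
    · exact (hzero m).apply_of_getElem?_eq hj
    · exact (hone m).apply_of_getElem?_eq hj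

/-- The generalized Beatty sequence whose value at `n ≥ 1` is the position in `r σ(x)` of the letter
with index `j` of the `n`-th block `σ(0)`, where `x` is the Fibonacci word and `σ : 0 ↦ u, 1 ↦ v`.
The first letter of `r σ(x)` has position `1`. -/
noncomputable def zeroBlockPosition (r u v : List A) (j : ℕ) : ℕ → ℤ :=
  generalizedBeatty goldenRatio v.length (u.length - v.length) (r.length - u.length + 1 + j)

/-- The generalized Beatty sequence whose value at `n ≥ 1` is the position in `r σ(x)` of the letter
with index `j` of the `n`-th block `σ(1)`, where `x` is the Fibonacci word and `σ : 0 ↦ u, 1 ↦ v`.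
The first letter of `r σ(x)` has position `1`. -/
noncomputable def oneBlockPosition (r u v : List A) (j : ℕ) : ℕ → ℤ :=
  generalizedBeatty goldenRatio u.length v.length (r.length - v.length + 1 + j)

theorem zeroBlockPosition_zero (r u v : List A) (j : ℕ) :
    zeroBlockPosition r u v j 0 = r.length - u.length + 1 + j :=
  generalizedBeatty_zero _ _ _ _

theorem zeroBlockPosition_succ (r u v : List A) (j m : ℕ) :
    zeroBlockPosition r u v j (m + 1) = (blockStart r u v (fibImageStart m) + j : ℕ) + 1 := by
  rw [zeroBlockPosition, generalizedBeatty, floor_add_one_mul_goldenRatio,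
    blockStart_fibImageStart]
  push_cast
  ring

theorem oneBlockPosition_succ (r u v : List A) (j m : ℕ) :
    oneBlockPosition r u v j (m + 1) =
      (blockStart r u v (fibImageStart (fibImageStart m) + 1) + j : ℕ) + 1 := by
  rw [oneBlockPosition, generalizedBeatty, floor_add_one_mul_goldenRatio,
    blockStart_fibImageStart_fibImageStart_add_one]
  push_cast
  ring

theorem strictMono_zeroBlockPosition (r : List A) {u : List A} (hu : u ≠ []) (v : List A) (j : ℕ) :
    StrictMono (zeroBlockPosition r u v j) := by
  refine strictMono_generalizedBeatty one_lt_goldenRatio.le _ (Int.natCast_nonneg _) ?_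
  rw [add_sub_cancel]
  exact_mod_cast List.length_pos_of_ne_nil hu

theorem strictMono_oneBlockPosition (r : List A) {u : List A} (hu : u ≠ []) (v : List A) (j : ℕ) :
    StrictMono (oneBlockPosition r u v j) := by
  have := List.length_pos_of_ne_nil hu
  exact strictMono_generalizedBeatty one_lt_goldenRatio.le _ (Int.natCast_nonneg _) (by omega)

theorem finite_setOf_getElem?_eq_some (l : List A) (a : A) : {j : ℕ | l[j]? = some a}.Finite :=
  (Set.finite_Iio l.length).subset fun _ hj => (List.getElem?_eq_some_iff.1 hj).1

theorem IsFibConcat.letterPositions_eq (h : IsFibConcat y r (z ++ r) v) (hzr : z ++ r ≠ [])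
    (hv : v ≠ []) (a : A) :
    letterPositions y a =
      (⋃ j ∈ {j | (z ++ r)[j]? = some a},
        zeroBlockPosition r (z ++ r) v j '' Set.Ici (if z.length ≤ j then 0 else 1)) ∪
      ⋃ j ∈ {j | v[j]? = some a}, oneBlockPosition r (z ++ r) v j '' Set.Ici 1 := by
  ext m
  simp only [letterPositions, h.apply_eq_iff hzr hv, Set.mem_ofPred_eq, Set.mem_union,
    Set.mem_iUnion, Set.mem_image, Set.mem_Ici, exists_prop]
  constructor
  · rintro ⟨n, hn | ⟨j, hj, k, rfl⟩ | ⟨j, hj, k, rfl⟩, rfl⟩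
    · refine Or.inl ⟨z.length + n, ?_, 0, ?_, ?_⟩
      · rwa [List.getElem?_append_right (Nat.le_add_right _ _), Nat.add_sub_cancel_left]
      · rw [if_pos (Nat.le_add_right _ _)]
      · rw [zeroBlockPosition_zero, List.length_append]
        push_cast
        ring
    · refine Or.inl ⟨j, hj, k + 1, ?_, zeroBlockPosition_succ ..⟩
      split_ifs <;> omega
    · exact Or.inr ⟨j, hj, k + 1, Nat.le_add_left _ _, oneBlockPosition_succ ..⟩
  · rintro (⟨j, hj, _ | k, hk, rfl⟩ | ⟨j, hj, _ | k, hk, rfl⟩)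
    · have hzj : z.length ≤ j := by
        by_contra hlt
        rw [if_neg hlt] at hk
        omega
      refine ⟨j - z.length, Or.inl ?_, ?_⟩
      · rwa [← List.getElem?_append_right hzj]
      · rw [zeroBlockPosition_zero, List.length_append]
        push_cast [hzj]
        ring
    · exact ⟨_, Or.inr (Or.inl ⟨j, hj, k, rfl⟩), zeroBlockPosition_succ ..⟩
    · omega
    · exact ⟨_, Or.inr (Or.inr ⟨j, hj, k, rfl⟩), oneBlockPosition_succ ..⟩

theorem IsFibConcat.isFiniteUnionGBS_letterPositions (h : IsFibConcat y r u v) (hu : u ≠ [])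
    (hv : v ≠ []) (hr : r <:+ u) (a : A) :
    IsFiniteUnionGBS goldenRatio (letterPositions y a) := by
  obtain ⟨z, rfl⟩ := hr
  rw [h.letterPositions_eq hu hv]
  refine IsFiniteUnionGBS.union
    (isFiniteUnionGBS_biUnion (finite_setOf_getElem?_eq_some _ a) fun j _ => ?_)
    (isFiniteUnionGBS_biUnion (finite_setOf_getElem?_eq_some _ a) fun j _ => ?_)
  · exact isFiniteUnionGBS_image_Ici (isGBS_generalizedBeatty _ _ _ _)
      (strictMono_zeroBlockPosition r hu v j) (ite_eq_or_eq _ _ _)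
  · exact isFiniteUnionGBS_image_Ici (isGBS_generalizedBeatty _ _ _ _)
      (strictMono_oneBlockPosition r hu v j) (Or.inr rfl)

end LetterPositions

section Replacement

variable {A : Type*} [DecidableEq A] {x : ℕ → A} {w l : List A} {n : ℕ}

theorem replaceStart_succ_of_occursAt (h : OccursAt x w (replaceStart x w n)) :
    replaceStart x w (n + 1) = replaceStart x w n + w.length :=
  if_pos h

theorem replaceStart_add {d : ℕ} (h : ∀ j < d, ¬ OccursAt x w (replaceStart x w n + j)) :
    replaceStart x w (n + d) = replaceStart x w n + d := by
  induction d with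
  | zero => rfl
  | succ d ih =>
    rw [← add_assoc, replaceStart, ih fun j hj => h j (hj.trans d.lt_succ_self),
      if_neg (h d d.lt_succ_self), add_assoc]

theorem occursAt_wordReplace (c : A) (hl : OccursAt x l (replaceStart x w n))
    (h : ∀ j < l.length, ¬ OccursAt x w (replaceStart x w n + j)) :
    OccursAt (wordReplace w c x) l n := by
  refine occursAt_iff.2 fun j hj => ?_
  rw [wordReplace, replaceStart_add fun i hi => h i (hi.trans hj), if_neg (h j hj)]
  exact occursAt_iff.1 hl j hj

theorem occursAt_wordReplace_cons (c : A) (hl : OccursAt x (w ++ l) (replaceStart x w n))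
    (h : ∀ j < l.length, ¬ OccursAt x w (replaceStart x w n + w.length + j)) :
    OccursAt (wordReplace w c x) (c :: l) n := by
  obtain ⟨hw, hl⟩ := occursAt_append.1 hl
  rw [← replaceStart_succ_of_occursAt hw] at hl h
  exact occursAt_cons.2 ⟨if_pos hw, occursAt_wordReplace c hl h⟩

theorem replaceStart_add_length_succ (hw : OccursAt x w (replaceStart x w n))
    (h : ∀ j < l.length, ¬ OccursAt x w (replaceStart x w n + w.length + j)) :
    replaceStart x w (n + (l.length + 1)) = replaceStart x w n + (w ++ l).length := by
  rw [← replaceStart_succ_of_occursAt hw] at h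
  rw [add_comm l.length, ← add_assoc, replaceStart_add h, replaceStart_succ_of_occursAt hw,
    List.length_append, add_assoc]

end Replacement

namespace IsReturnDecomposition

variable {w r u v s t : List ℕ}

theorem not_occursAt_of_lt (h : IsReturnDecomposition w r u v) {i : ℕ} (hi : i < r.length) :
    ¬ OccursAt fibWord w i := by
  rw [h.occursAt_iff]
  rintro ⟨k, rfl⟩
  exact hi.not_ge ((blockStart_strictMono r h.left_ne_nil h.right_ne_nil).monotone k.zero_le)

theorem not_occursAt_blockStart_add (h : IsReturnDecomposition w r u v) {k j : ℕ} (hj : 0 < j)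
    (hjk : j < (fibBlock u v k).length) : ¬ OccursAt fibWord w (blockStart r u v k + j) := by
  have hmono := blockStart_strictMono r h.left_ne_nil h.right_ne_nil
  rw [h.occursAt_iff]
  rintro ⟨m, hm⟩
  have hkm : k < m := hmono.lt_iff_lt.1 (by omega)
  have hmk : m < k + 1 := hmono.lt_iff_lt.1 (by rw [blockStart_succ]; omega)
  omega

theorem nth_occursAt (h : IsReturnDecomposition w r u v) (k : ℕ) :
    Nat.nth (OccursAt fibWord w) k = blockStart r u v k := by
  have hmono := blockStart_strictMono r h.left_ne_nil h.right_ne_nil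
  have hinf : (Set.ofPred (OccursAt fibWord w)).Infinite :=
    Set.infinite_of_injective_forall_mem hmono.injective h.occursAt_blockStart
  rw [← Nat.nth_comp_of_strictMono hmono (fun i => (h.occursAt_iff i).1)
    fun hfin => (hinf hfin).elim]
  simp only [h.occursAt_blockStart, Nat.nth_true]

theorem length_returnWord_zero (h : IsReturnDecomposition w r u v) :
    (returnWord fibWord w 0).length = r.length := by
  rw [returnWord, length_wordSegment, h.nth_occursAt, blockStart_zero, Nat.sub_zero]

theorem length_returnWord_succ (h : IsReturnDecomposition w r u v) (k : ℕ) :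
    (returnWord fibWord w (k + 1)).length = (fibBlock u v k).length := by
  rw [returnWord, length_wordSegment, h.nth_occursAt, h.nth_occursAt, blockStart_succ,
    Nat.add_sub_cancel_left]

theorem prefix_fibBlock (h : IsReturnDecomposition w r u v) (hno : ¬ HasOverlap fibWord w)
    (k : ℕ) : w <+: fibBlock u v k := by
  refine (h.occursAt_blockStart k).prefix_of_length_le (h.occursAt_block k) ?_
  by_contra! hlt
  exact hno (hasOverlap_of_occursAt (h.occursAt_blockStart k) (h.occursAt_blockStart (k + 1))
    (List.length_pos_of_ne_nil (fibBlock_ne_nil h.left_ne_nil h.right_ne_nil k)) hlt)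

theorem not_occursAt_blockStart_add_length_add (h : IsReturnDecomposition w r (w ++ s) (w ++ t))
    (hw : w ≠ []) {k j : ℕ} (hj : j < (fibBlock s t k).length) :
    ¬ OccursAt fibWord w (blockStart r (w ++ s) (w ++ t) k + w.length + j) := by
  have := List.length_pos_of_ne_nil hw
  rw [add_assoc]
  refine h.not_occursAt_blockStart_add (by omega) ?_
  rw [← apply_fibBlock (w ++ ·), List.length_append]
  omega

theorem replaceStart_blockStart (h : IsReturnDecomposition w r (w ++ s) (w ++ t)) (hw : w ≠ [])
    (c k : ℕ) : replaceStart fibWord w (blockStart r (c :: s) (c :: t) k) =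
      blockStart r (w ++ s) (w ++ t) k := by
  induction k with
  | zero =>
    have := replaceStart_add (x := fibWord) (w := w) (n := 0) (d := r.length) fun j hj => by
      rw [replaceStart, zero_add]
      exact h.not_occursAt_of_lt hj
    simpa [replaceStart, blockStart_zero] using this
  | succ k ih =>
    rw [blockStart_succ, blockStart_succ, ← apply_fibBlock (c :: ·), ← apply_fibBlock (w ++ ·),
      List.length_cons, replaceStart_add_length_succ, ih]
    · rw [ih]
      exact h.occursAt_blockStart k
    · rw [ih]
      exact fun j => h.not_occursAt_blockStart_add_length_add hw

theorem isFibConcat_wordReplace (h : IsReturnDecomposition w r (w ++ s) (w ++ t)) (hw : w ≠ [])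
    (c : ℕ) : IsFibConcat (wordReplace w c fibWord) r (c :: s) (c :: t) where
  occursAt_prefix := occursAt_wordReplace (n := 0) c h.occursAt_prefix fun j hj => by
    rw [replaceStart, zero_add]
    exact h.not_occursAt_of_lt hj
  occursAt_block k := by
    have hblock := h.occursAt_block k
    rw [← apply_fibBlock (w ++ ·), ← h.replaceStart_blockStart hw c] at hblock
    rw [← apply_fibBlock (c :: ·)]
    refine occursAt_wordReplace_cons c hblock ?_
    rw [h.replaceStart_blockStart hw]
    exact fun j => h.not_occursAt_blockStart_add_length_add hw

theorem isFiniteUnionGBS_letterPositions_wordReplace (h : IsReturnDecomposition w r u v)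
    (hw : w ≠ []) (hno : ¬ HasOverlap fibWord w) (hr : r.length + w.length ≤ u.length) (c a : ℕ) :
    IsFiniteUnionGBS Real.goldenRatio (letterPositions (wordReplace w c fibWord) a) := by
  obtain ⟨s, rfl⟩ : w <+: u := h.prefix_fibBlock hno 0
  obtain ⟨t, rfl⟩ : w <+: v := h.prefix_fibBlock hno 1
  obtain ⟨W, hrW, hsW⟩ := h.exists_suffix
  have hrs : r <:+ s := by
    refine List.suffix_of_suffix_length_le hrW ((List.suffix_append w s).trans hsW) ?_
    rw [List.length_append] at hr
    omega
  exact (h.isFibConcat_wordReplace hw c).isFiniteUnionGBS_letterPositions (List.cons_ne_nil c s)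
    (List.cons_ne_nil c t) (hrs.trans (List.suffix_cons c s)) a

end IsReturnDecomposition

theorem mainTheorem12 (w : List ℕ) (hw : w ≠ []) (hfac : IsFactor fibWord w)
    (hno : ¬ HasOverlap fibWord w)
    (hSR0 : ((returnWord fibWord w 0).length : ℤ)
      ≤ ((returnWord fibWord w 1).length : ℤ) - (w.length : ℤ)) :
    IsFiniteUnionGBS Real.goldenRatio (letterPositions (wordReplace w 2 fibWord) 0) ∧
    IsFiniteUnionGBS Real.goldenRatio (letterPositions (wordReplace w 2 fibWord) 1) ∧
    IsFiniteUnionGBS Real.goldenRatio (letterPositions (wordReplace w 2 fibWord) 2) := by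
  obtain ⟨r, u, v, h⟩ := exists_isReturnDecomposition hfac
  have hr : r.length + w.length ≤ u.length := by
    rw [h.length_returnWord_zero, h.length_returnWord_succ,
      fibBlock_of_eq_zero fibWord_zero] at hSR0
    omega
  have hletter (a : ℕ) := h.isFiniteUnionGBS_letterPositions_wordReplace hw hno hr 2 a
  exact ⟨hletter 0, hletter 1, hletter 2⟩
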